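/- Let $\lambda,\mu>0$ and $\alpha=\sqrt{\mu/\lambda}$. Consider the forward Kolmogorov equations of the discouragement queue (the birth and death process on $\{0,1,2,\dots\}$ with birth rates $\lambda_k=\lambda/(1+k)$ and death rates $\mu_k=\mu k$) started in state $0$: for $t\ge 0$, $$q'(0,t)=-\lambda q(0,t)+\mu q(1,t),\qquad q'(k,t)=\tfrac{\lambda}{k}q(k-1,t)-\Big(\tfrac{\lambda}{1+k}+k\mu\Big)q(k,t)+(k+1)\mu\, q(k+1,t)\quad(k\ge 1),$$ with $q(0,0)=1$ and $q(k,0)=0$ for $k\ge1$. A family $q$ solves this problem if and only if $p(k,\tau)=q(k,\tau/\lambda)$ solves the rescaled Cauchy problem, for $\tau\ge 0$, $$\dot p(0,\tau)=-p(0,\tau)+\alpha^2p(1,\tau),\qquad \dot p(k,\tau)=\tfrac1k p(k-1,\tau)-b_k\,p(k,\tau)+(k+1)\alpha^2p(k+1,\tau)\quad(k\ge1),$$ $$p(0,0)=1,\qquad p(k,0)=0\quad(k\ge 1),$$ where $b_k=\frac1{k+1}+k\alpha^2$ (derivatives at time $0$ are right derivatives). Let $S^{(k)}_i$ ($k,i\ge0$)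 be the unique array with $S^{(0)}_0=1$, $S^{(k)}_i=0$ for $k>i$ and $$S^{(k+1)}_i=S^{(k)}_{i+1}+b_kS^{(k)}_i-\alpha^2S^{(k-1)}_i\qquad(i\ge0,\ 0\le k\le i+1),\qquad S^{(-1)}_i=0.$$ Then for every $k\ge0$ the power series $\sum_{i\ge0}\frac{\tau^i}{i!}S^{(k)}_i$ has infinite radius of convergence, and $$p(k,\tau)=\frac1{\alpha^{2k}k!}\sum_{i=0}^{\infty}\frac{\tau^i}{i!}S^{(k)}_i\qquad(k\ge0,\ \tau\ge0)$$ is a solution of the rescaled Cauchy problem. Each $p(k,\cdot)$ is real analytic on $[0,\infty)$, and for every $\tau\ge0$ the numbers $p(k,\tau)$, $k\ge0$, form a probability distribution (they are non-negative with sum $1$). It is the unique solution of the rescaled Cauchy problem on $[0,\infty)$ in each of the following two classes: (a) the solutions that are a probability distribution at every time $\tau\ge0$; (b) the solutions whose component $p(0,\cdot)$ is real analytic on $[0,\infty)$ (in particular, those for which $p(0,\cdot)$ is the sum of an everywhere convergent power series). -/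

import Mathlib

open Set

/-- The forward Kolmogorov equations on `t ≥ 0` of the birth and death process on `ℕ` with birth
rates `lam / (1 + k)` and death rates `mu * k`, started in state `0`; `q k t` plays the role of
`P(X(t) = k)`. The derivative at `t = 0` is the right derivative. -/
structure IsForwardSolution (lam mu : ℝ) (q : ℕ → ℝ → ℝ) : Prop where
  init_zero : q 0 0 = 1
  init_pos : ∀ k : ℕ, 0 < k → q k 0 = 0
  ode_zero : ∀ t : ℝ, 0 ≤ t →
    HasDerivWithinAt (q 0) (-lam * q 0 t + mu * q 1 t) (Ici 0) t
  ode_pos : ∀ k : ℕ, 1 ≤ k → ∀ t : ℝ, 0 ≤ t →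
    HasDerivWithinAt (q k)
      (lam / (k : ℝ) * q (k - 1) t - (lam / (1 + (k : ℝ)) + (k : ℝ) * mu) * q k t
        + ((k : ℝ) + 1) * mu * q (k + 1) t) (Ici 0) t

/-- The Cauchy problem in the rescaled time `τ = lam * t`, with `α ^ 2 = mu / lam`. -/
structure IsRescaledSolution (α : ℝ) (p : ℕ → ℝ → ℝ) : Prop where
  init_zero : p 0 0 = 1
  init_pos : ∀ k : ℕ, 0 < k → p k 0 = 0
  ode_zero : ∀ τ : ℝ, 0 ≤ τ →
    HasDerivWithinAt (p 0) (-p 0 τ + α ^ 2 * p 1 τ) (Ici 0) τ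
  ode_pos : ∀ k : ℕ, 1 ≤ k → ∀ τ : ℝ, 0 ≤ τ →
    HasDerivWithinAt (p k)
      (1 / (k : ℝ) * p (k - 1) τ - (1 / (1 + (k : ℝ)) + (k : ℝ) * α ^ 2) * p k τ
        + ((k : ℝ) + 1) * α ^ 2 * p (k + 1) τ) (Ici 0) τ

/-- At every time `τ ≥ 0` the numbers `p k τ`, `k ∈ ℕ`, form a probability distribution. -/
def IsDistributionValued (p : ℕ → ℝ → ℝ) : Prop :=
  ∀ τ : ℝ, 0 ≤ τ → (∀ k : ℕ, 0 ≤ p k τ) ∧ HasSum (fun k : ℕ => p k τ) 1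

/-- `b_k = 1 / (k + 1) + k α²`. -/
noncomputable def totalRate (α : ℝ) (k : ℕ) : ℝ :=
  1 / ((k : ℝ) + 1) + (k : ℝ) * α ^ 2

/-- `taylorCoeff α k i` is `S^{(k)}_i`. The three-term recursion
`S^{(k+1)}_i = S^{(k)}_{i+1} + b_k S^{(k)}_i - α² S^{(k-1)}_i` with `S^{(-1)}_i = 0` is solved for
its term with lower index `i + 1`; see `taylorCoeff_iff`. -/
noncomputable def taylorCoeff (α : ℝ) : ℕ → ℕ → ℝ
  | 0, 0 => 1
  | _ + 1, 0 => 0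
  | 0, i + 1 => taylorCoeff α 1 i - totalRate α 0 * taylorCoeff α 0 i
  | k + 1, i + 1 =>
      taylorCoeff α (k + 2) i - totalRate α (k + 1) * taylorCoeff α (k + 1) i
        + α ^ 2 * taylorCoeff α k i

/-- `p(k, τ) = (1 / (α^{2k} k!)) ∑_i (τ^i / i!) S^{(k)}_i`. -/
noncomputable def seriesSolution (α : ℝ) (k : ℕ) (τ : ℝ) : ℝ :=
  1 / (α ^ (2 * k) * (Nat.factorial k : ℝ)) *
    ∑' i : ℕ, τ ^ i / (Nat.factorial i : ℝ) * taylorCoeff α k i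

/-- The array `taylorCoeff α` is the only one that satisfies the three-term recursion and its
boundary conditions. -/
theorem taylorCoeff_iff (α : ℝ) (S : ℕ → ℕ → ℝ) :
    (S 0 0 = 1 ∧ (∀ k i : ℕ, i < k → S k i = 0) ∧
      (∀ i : ℕ, S 1 i = S 0 (i + 1) + totalRate α 0 * S 0 i) ∧
      (∀ k i : ℕ, 1 ≤ k → k ≤ i + 1 →
        S (k + 1) i = S k (i + 1) + totalRate α k * S k i - α ^ 2 * S (k - 1) i)) ↔
    S = taylorCoeff α := by
  constructor
  · rintro ⟨h0, hz, h1, hk⟩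
    suffices h : ∀ i k : ℕ, S k i = taylorCoeff α k i by
      funext k i
      exact h i k
    intro i
    induction i with
    | zero =>
      intro k
      cases k with
      | zero => simp [taylorCoeff, h0]
      | succ k => simp [taylorCoeff, hz (k + 1) 0 (by omega)]
    | succ i ih =>
      intro k
      cases k with
      | zero =>
        have := h1 i
        rw [taylorCoeff, ← ih, ← ih]
        linarith
      | succ k =>
        rw [taylorCoeff, ← ih, ← ih, ← ih]
        by_cases hki : k ≤ i
        · have := hk (k + 1) i (by omega) (by omega)
          simp only [Nat.add_sub_cancel] at this
          linarith
        · rw [hz (k + 1) (i + 1) (by omega), hz (k + 2) i (by omega), hz (k + 1) i (by omega),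
            hz k i (by omega)]
          ring
  · rintro rfl
    refine ⟨by simp [taylorCoeff], ?_, ?_, ?_⟩
    · intro k i
      induction i generalizing k with
      | zero =>
        intro h
        cases k with
        | zero => omega
        | succ k => simp [taylorCoeff]
      | succ i ih =>
        intro h
        cases k with
        | zero => omega
        | succ k =>
          rw [taylorCoeff, ih (k + 2) (by omega), ih (k + 1) (by omega), ih k (by omega)]
          ring
    · intro i
      rw [taylorCoeff]
      ring
    · intro k i h _
      cases k with
      | zero => omega
      | succ k =>
        rw [taylorCoeff]
        simp only [Nat.add_sub_cancel]
        ring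

/-! Write the system as p' = Ap, with A = `forwardOp`. The three-term recursion says that the
normalised coefficients are the entries of A^i e_0 (`scaledCoeff_succ`), so the series is
exp(τA)e_0. As A is unbounded, convergence needs an estimate. In generating functions A is dominated
by w + a w d/dw with w = 1 + z and a = α². The i-th iterate of this operator on 1 is dominated by
∑_n C(i,n)(an)^{i-n} w^n, whose exponential generating function exp(w t e^{at}) is entire
(`abs_scaledCoeff_le`, `summable_totalBound`). At w = 2 this bounds the ℓ¹ norm of A^i e_0, so the
series may be differentiated termwise and summed over k.

Positivity and uniqueness in class (a) come from a minimum principle for bounded solutions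
(`SolvesForward.nonneg`); total mass 1 comes from the telescoping of the column sums of A. In class
(b), all right derivatives at 0 of the difference of two solutions vanish, so by analyticity its
component 0 vanishes; solving the equations upwards in k then kills the other components. -/

/-- The right-hand side of the rescaled forward equations, with `a = α ^ 2`. -/
noncomputable def forwardOp (a : ℝ) (x : ℕ → ℝ) : ℕ → ℝ
  | 0 => -x 0 + a * x 1
  | k + 1 => 1 / ((k : ℝ) + 1) * x k - (1 / ((k : ℝ) + 2) + ((k : ℝ) + 1) * a) * x (k + 1)
      + ((k : ℝ) + 2) * a * x (k + 2)

/-- The family `p` satisfies the rescaled forward equations on `[0, ∞)`. -/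
def SolvesForward (a : ℝ) (p : ℕ → ℝ → ℝ) : Prop :=
  ∀ k : ℕ, ∀ t : ℝ, 0 ≤ t → HasDerivWithinAt (p k) (forwardOp a (fun j => p j t) k) (Ici 0) t

theorem isRescaledSolution_iff (α : ℝ) (p : ℕ → ℝ → ℝ) :
    IsRescaledSolution α p ↔
      (p 0 0 = 1 ∧ (∀ k, 0 < k → p k 0 = 0)) ∧ SolvesForward (α ^ 2) p := by
  constructor
  · rintro ⟨h0, h1, h2, h3⟩
    refine ⟨⟨h0, h1⟩, fun k t ht => ?_⟩
    cases k with
    | zero => exact h2 t ht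
    | succ k =>
      convert h3 (k + 1) (by omega) t ht using 1
      simp only [forwardOp, Nat.add_sub_cancel]
      push_cast
      ring
  · rintro ⟨⟨h0, h1⟩, h2⟩
    refine ⟨h0, h1, h2 0, fun k hk t ht => ?_⟩
    obtain ⟨k, rfl⟩ := Nat.exists_eq_add_of_le' hk
    convert h2 (k + 1) t ht using 1
    simp only [forwardOp, Nat.add_sub_cancel]
    push_cast
    ring

theorem forwardOp_sub (a : ℝ) (x y : ℕ → ℝ) (k : ℕ) :
    forwardOp a (fun j => x j - y j) k = forwardOp a x k - forwardOp a y k := by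
  cases k <;> simp only [forwardOp] <;> ring

theorem forwardOp_add (a : ℝ) (x y : ℕ → ℝ) (k : ℕ) :
    forwardOp a (fun j => x j + y j) k = forwardOp a x k + forwardOp a y k := by
  cases k <;> simp only [forwardOp] <;> ring

theorem SolvesForward.sub {a : ℝ} {p q : ℕ → ℝ → ℝ} (hp : SolvesForward a p)
    (hq : SolvesForward a q) : SolvesForward a (fun k t => p k t - q k t) := by
  intro k t ht
  rw [forwardOp_sub]
  exact (hp k t ht).sub (hq k t ht)

/-! ### Minimum principle and uniqueness of bounded solutions -/

theorem forwardOp_nonneg_of_eq_zero {a : ℝ} (ha : 0 ≤ a) {x : ℕ → ℝ} (hx : ∀ j, 0 ≤ x j) {k : ℕ}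
    (hk : x k = 0) : 0 ≤ forwardOp a x k := by
  cases k with
  | zero =>
    have := mul_nonneg ha (hx 1)
    simp only [forwardOp, hk]
    linarith
  | succ k =>
    have h1 := hx k
    have h2 := hx (k + 2)
    simp only [forwardOp, hk]
    simp only [mul_zero, sub_zero]
    positivity

/-- Makes e^{(2+2a)t}(k+1) a strict supersolution that grows in k, the barrier for the minimum
principle. For k ≥ 1 the birth terms cancel on linear sequences, leaving 2a(k+1). -/
theorem forwardOp_linear_lt {a : ℝ} (ha : 0 ≤ a) {E : ℝ} (hE : 0 < E) (k : ℕ) :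
    forwardOp a (fun j => E * ((j : ℝ) + 1)) k < E * ((k : ℝ) + 1) * (2 + 2 * a) := by
  cases k with
  | zero =>
    simp only [forwardOp]
    push_cast
    nlinarith [mul_nonneg ha hE.le]
  | succ k =>
    have h : forwardOp a (fun j => E * ((j : ℝ) + 1)) (k + 1)
        = E * (2 * a * ((k : ℝ) + 2)) := by
      simp only [forwardOp]
      push_cast
      field_simp
      ring
    rw [h]
    push_cast
    have : (0 : ℝ) ≤ k := k.cast_nonneg
    nlinarith [mul_nonneg hE.le this]

/-- Minimum principle for bounded solutions of the forward equations. -/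
theorem SolvesForward.nonneg {a : ℝ} (ha : 0 ≤ a) {d : ℕ → ℝ → ℝ} (hd : SolvesForward a d)
    (h0 : ∀ k, 0 ≤ d k 0) {T C : ℝ} (hC : ∀ k, ∀ t ∈ Icc 0 T, -C ≤ d k t) :
    ∀ k, ∀ t ∈ Icc 0 T, 0 ≤ d k t := by
  suffices H : ∀ ε : ℝ, 0 < ε → ∀ t ∈ Icc 0 T, ∀ k : ℕ,
      0 < d k t + ε * Real.exp ((2 + 2 * a) * t) * ((k : ℝ) + 1) by
    intro k t ht
    refine le_of_forall_pos_lt_add fun δ hδ => ?_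
    have hpos : 0 < Real.exp ((2 + 2 * a) * t) * ((k : ℝ) + 1) := by positivity
    have := H (δ / (Real.exp ((2 + 2 * a) * t) * ((k : ℝ) + 1))) (by positivity) t ht k
    rwa [mul_assoc, div_mul_cancel₀ _ hpos.ne'] at this
  intro ε hε
  set c := 2 + 2 * a with hc
  set u : ℕ → ℝ → ℝ := fun k t => d k t + ε * Real.exp (c * t) * ((k : ℝ) + 1) with hu
  have hcont : ∀ k, ContinuousOn (u k) (Icc 0 T) := by
    intro k
    have h1 : ContinuousOn (d k) (Icc 0 T) := fun t ht =>
      ((hd k t ht.1).continuousWithinAt).mono Icc_subset_Ici_self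
    exact h1.add (Continuous.continuousOn (by fun_prop))
  -- From index K on, the barrier exceeds the lower bound C, so only finitely many components can
  -- reach 0 and a first such time exists.
  obtain ⟨K, hK⟩ := exists_nat_gt (C / ε)
  have hlarge : ∀ k, K ≤ k → ∀ t ∈ Icc 0 T, 0 < u k t := by
    intro k hk t ht
    have h1 : C < K * ε := (div_lt_iff₀ hε).1 hK
    have h2 : (K : ℝ) ≤ k := Nat.cast_le.2 hk
    have h3 : 1 ≤ Real.exp (c * t) := Real.one_le_exp (mul_nonneg (by positivity) ht.1)
    have h4 : ε * ((k : ℝ) + 1) ≤ ε * Real.exp (c * t) * ((k : ℝ) + 1) := by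
      have : 0 ≤ ε * ((k : ℝ) + 1) := by positivity
      nlinarith
    have := hC k t ht
    simp only [hu]
    nlinarith
  by_contra hcon
  push Not at hcon
  obtain ⟨t1, ht1, k1, hk1⟩ := hcon
  set Z : Set ℝ := ⋃ k ∈ Finset.range K, {t ∈ Icc 0 T | u k t ≤ 0} with hZ
  have hZc : IsCompact Z := by
    refine Finset.isCompact_biUnion _ fun k _ => ?_
    exact isCompact_Icc.of_isClosed_subset
      ((hcont k).preimage_isClosed_of_isClosed isClosed_Icc isClosed_Iic) fun t ht => ht.1
  have hmem : ∀ t, t ∈ Icc 0 T → ∀ k, u k t ≤ 0 → t ∈ Z := by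
    intro t ht k hk
    have hkK : k < K := by
      by_contra hlt
      exact absurd (hlarge k (not_lt.1 hlt) t ht) (not_lt.2 hk)
    simp only [hZ, mem_iUnion]
    exact ⟨k, Finset.mem_range.2 hkK, ht, hk⟩
  obtain ⟨s, hsZ, hsmin⟩ := hZc.exists_isLeast ⟨t1, hmem t1 ht1 k1 hk1⟩
  obtain ⟨k, hsI, hk⟩ : ∃ k, s ∈ Icc 0 T ∧ u k s ≤ 0 := by
    simp only [hZ, mem_iUnion] at hsZ
    obtain ⟨k, _, h⟩ := hsZ
    exact ⟨k, h⟩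
  have hs0 : 0 < s := by
    rcases hsI.1.lt_or_eq with h | h
    · exact h
    · exfalso
      rw [← h] at hk
      have h1 := h0 k
      have h2 : 0 < ε * Real.exp (c * 0) * ((k : ℝ) + 1) := by positivity
      simp only [hu] at hk
      linarith
  have hbefore : ∀ j, ∀ t ∈ Ico 0 s, 0 < u j t := by
    intro j t ht
    by_contra hle
    exact absurd (hsmin (hmem t ⟨ht.1, ht.2.le.trans hsI.2⟩ j (not_lt.1 hle))) (not_le.2 ht.2)
  have hev : ∀ᶠ t in nhdsWithin s (Iio s), t ∈ Ico 0 s := by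
    filter_upwards [self_mem_nhdsWithin, nhdsWithin_le_nhds (Ioi_mem_nhds hs0)] with t h1 h2
    exact ⟨le_of_lt h2, h1⟩
  have hnonneg : ∀ j, 0 ≤ u j s := by
    intro j
    have hc1 : Filter.Tendsto (u j) (nhdsWithin s (Iio s)) (nhds (u j s)) := by
      refine ((hcont j) s hsI).mono_left ?_
      refine nhdsWithin_le_iff.2 ?_
      filter_upwards [hev] with t ht
      exact ⟨ht.1, ht.2.le.trans hsI.2⟩
    exact ge_of_tendsto hc1 (hev.mono fun t ht => (hbefore j t ht).le)
  have hks : u k s = 0 := le_antisymm hk (hnonneg k)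
  have hder : HasDerivAt (u k) (forwardOp a (fun j => d j s) k
      + ε * (Real.exp (c * s) * c) * ((k : ℝ) + 1)) s := by
    have h1 := (hd k s hs0.le).hasDerivAt (Ici_mem_nhds hs0)
    have h2 : HasDerivAt (fun t => Real.exp (c * t)) (Real.exp (c * s) * c) s := by
      simpa using ((hasDerivAt_id s).const_mul c).exp
    exact h1.add ((h2.const_mul ε).mul_const _)
  -- At the first zero, Au ≥ 0 in the vanishing component because the off-diagonal entries of A are
  -- nonnegative; strictness of the barrier makes the derivative positive, while the left slopes
  -- make it nonpositive.
  have hpos : 0 < forwardOp a (fun j => d j s) k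
      + ε * (Real.exp (c * s) * c) * ((k : ℝ) + 1) := by
    have h1 := forwardOp_nonneg_of_eq_zero ha (x := fun j => u j s) hnonneg hks
    have h2 := forwardOp_linear_lt ha (E := ε * Real.exp (c * s)) (by positivity) k
    simp only [hu] at h1
    rw [forwardOp_add] at h1
    linarith
  have hle : forwardOp a (fun j => d j s) k
      + ε * (Real.exp (c * s) * c) * ((k : ℝ) + 1) ≤ 0 := by
    have h1 := (hasDerivWithinAt_iff_tendsto_slope' (s := Iio s) (by simp)).1
      hder.hasDerivWithinAt
    refine le_of_tendsto h1 (hev.mono fun t ht => ?_)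
    rw [slope_def_field, hks, sub_zero]
    exact div_nonpos_of_nonneg_of_nonpos (hbefore k t ht).le (by linarith [ht.2])
  linarith

/-- Bounded solutions of the forward equations that vanish at time `0` vanish identically. -/
theorem SolvesForward.eq_zero_of_bounded {a : ℝ} (ha : 0 ≤ a) {d : ℕ → ℝ → ℝ}
    (hd : SolvesForward a d) (h0 : ∀ k, d k 0 = 0) {T C : ℝ}
    (hC : ∀ k, ∀ t ∈ Icc 0 T, |d k t| ≤ C) : ∀ k, ∀ t ∈ Icc 0 T, d k t = 0 := by
  intro k t ht
  refine le_antisymm ?_ (hd.nonneg ha (fun k => (h0 k).ge)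
    (fun k t ht => (abs_le.1 (hC k t ht)).1) k t ht)
  have hz : SolvesForward a (fun _ _ => 0) := by
    intro k t _
    have : forwardOp a (fun _ => 0) k = 0 := by cases k <;> simp [forwardOp]
    rw [this]
    exact hasDerivWithinAt_const _ _ _
  have := (hz.sub hd).nonneg ha (fun k => by simp [h0 k]) (C := C) (T := T)
    (fun k t ht => by linarith [(abs_le.1 (hC k t ht)).2]) k t ht
  linarith

/-! ### Taylor coefficients and their majorant -/

/-- The Taylor coefficients `S^{(k)}_i / (α^{2k} k!)` of the components of the series solution. -/
noncomputable def scaledCoeff (α : ℝ) (k i : ℕ) : ℝ :=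
  taylorCoeff α k i / (α ^ (2 * k) * (Nat.factorial k : ℝ))

theorem scaledCoeff_succ {α : ℝ} (hα : α ≠ 0) (k i : ℕ) :
    scaledCoeff α k (i + 1) = forwardOp (α ^ 2) (fun j => scaledCoeff α j i) k := by
  cases k with
  | zero =>
    simp only [scaledCoeff, forwardOp, taylorCoeff, totalRate]
    field_simp
    simp
    ring
  | succ k =>
    have h1 : (Nat.factorial k : ℝ) ≠ 0 := by positivity
    simp only [scaledCoeff, forwardOp, taylorCoeff, totalRate, Nat.factorial_succ, pow_mul]
    push_cast
    field_simp
    ring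

theorem scaledCoeff_zero_zero (α : ℝ) : scaledCoeff α 0 0 = 1 := by
  simp [scaledCoeff, taylorCoeff]

theorem scaledCoeff_eq_zero (α : ℝ) {k i : ℕ} (h : i < k) : scaledCoeff α k i = 0 := by
  have := ((taylorCoeff_iff α (taylorCoeff α)).2 rfl).2.1 k i h
  simp [scaledCoeff, this]

theorem seriesSolution_eq_tsum (α : ℝ) (k : ℕ) (τ : ℝ) :
    seriesSolution α k τ = ∑' i : ℕ, τ ^ i / (Nat.factorial i : ℝ) * scaledCoeff α k i := by
  rw [seriesSolution, ← tsum_mul_left]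
  refine tsum_congr fun i => ?_
  rw [scaledCoeff]
  ring

/-- The coefficients of the polynomial `∑_n C(i,n) (a n)^{i-n} (1 + z)^n` in `z`. -/
noncomputable def coeffBound (a : ℝ) (i k : ℕ) : ℝ :=
  ∑ n ∈ Finset.range (i + 1), (i.choose n : ℝ) * (a * n) ^ (i - n) * (n.choose k : ℝ)

/-- The left side is the z^k coefficient of w + a w d/dw applied to the i-th polynomial, since w^n
becomes w^{n+1} + a n w^n. Pascal's rule for C(i+1,n+1) splits the right side in the same way, with
n + 1 in place of n in one base, which only increases it. -/
theorem coeffBound_succ_ge {a : ℝ} (ha : 0 ≤ a) (i k : ℕ) :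
    ∑ n ∈ Finset.range (i + 1), (i.choose n : ℝ) * (a * n) ^ (i - n)
        * (((n + 1).choose k : ℝ) + a * n * (n.choose k : ℝ))
      ≤ coeffBound a (i + 1) k := by
  have h1 : coeffBound a (i + 1) k
      = (∑ n ∈ Finset.range (i + 1),
          (i.choose n : ℝ) * (a * n) ^ (i - n) * (a * n * (n.choose k : ℝ)))
        + ∑ n ∈ Finset.range (i + 1),
          (i.choose n : ℝ) * (a * ((n : ℝ) + 1)) ^ (i - n) * ((n + 1).choose k : ℝ) := by
    have h2 : ∀ n ∈ Finset.range (i + 1),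
        (i.choose n : ℝ) * (a * n) ^ (i - n) * (a * n * (n.choose k : ℝ))
          = (i.choose n : ℝ) * (a * n) ^ (i + 1 - n) * (n.choose k : ℝ) := by
      intro n hn
      rw [Nat.succ_sub (Nat.lt_succ_iff.1 (Finset.mem_range.1 hn)), pow_succ]
      ring
    rw [coeffBound, Finset.sum_range_succ', Finset.sum_congr rfl h2]
    -- The added term n = i + 1 vanishes because C(i,i+1) = 0; the longer range lets the n = 0 term
    -- be split off.
    have h3 : ∑ n ∈ Finset.range (i + 1),
          (i.choose n : ℝ) * (a * n) ^ (i + 1 - n) * (n.choose k : ℝ)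
        = ∑ n ∈ Finset.range (i + 2),
          (i.choose n : ℝ) * (a * n) ^ (i + 1 - n) * (n.choose k : ℝ) := by
      rw [Finset.sum_range_succ _ (i + 1)]
      simp
    rw [h3, Finset.sum_range_succ' _ (i + 1), add_right_comm, ← Finset.sum_add_distrib]
    congr 1
    · refine Finset.sum_congr rfl fun n _ => ?_
      rw [Nat.choose_succ_succ, Nat.add_sub_add_right]
      push_cast
      ring
    · simp
  rw [h1, ← Finset.sum_add_distrib]
  refine Finset.sum_le_sum fun n _ => ?_
  have h4 : (a * (n : ℝ)) ^ (i - n) ≤ (a * ((n : ℝ) + 1)) ^ (i - n) := by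
    gcongr
    linarith
  have h5 : (i.choose n : ℝ) * (a * (n : ℝ)) ^ (i - n) * ((n + 1).choose k : ℝ)
      ≤ (i.choose n : ℝ) * (a * ((n : ℝ) + 1)) ^ (i - n) * ((n + 1).choose k : ℝ) := by gcongr
  linarith

theorem coeffBound_zero_succ {a : ℝ} (ha : 0 ≤ a) (i : ℕ) :
    coeffBound a i 0 + a * coeffBound a i 1 ≤ coeffBound a (i + 1) 0 := by
  refine le_trans (le_of_eq ?_) (coeffBound_succ_ge ha i 0)
  rw [coeffBound, coeffBound, Finset.mul_sum, ← Finset.sum_add_distrib]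
  refine Finset.sum_congr rfl fun n _ => ?_
  simp
  ring

theorem coeffBound_succ_succ {a : ℝ} (ha : 0 ≤ a) (i k : ℕ) :
    coeffBound a i k + (1 + ((k : ℝ) + 1) * a) * coeffBound a i (k + 1)
      + ((k : ℝ) + 2) * a * coeffBound a i (k + 2) ≤ coeffBound a (i + 1) (k + 1) := by
  refine le_trans (le_of_eq ?_) (coeffBound_succ_ge ha i (k + 1))
  rw [coeffBound, coeffBound, coeffBound, Finset.mul_sum, Finset.mul_sum,
    ← Finset.sum_add_distrib, ← Finset.sum_add_distrib]
  refine Finset.sum_congr rfl fun n _ => ?_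
  -- Coefficient form of differentiating (1+z)^n; for n < k + 1 both binomials vanish, so the real
  -- subtraction is harmless.
  have h1 : ((n.choose (k + 2) : ℝ)) * ((k : ℝ) + 2)
      = (n.choose (k + 1) : ℝ) * ((n : ℝ) - (k + 1)) := by
    have h := Nat.choose_succ_right_eq n (k + 1)
    rcases le_or_gt (k + 1) n with hle | hlt
    · have h' := congrArg (Nat.cast : ℕ → ℝ) h
      push_cast [Nat.cast_sub hle] at h'
      linarith
    · rw [Nat.choose_eq_zero_of_lt hlt, Nat.choose_eq_zero_of_lt (by omega)]
      simp
  rw [Nat.choose_succ_succ]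
  push_cast
  linear_combination (i.choose n : ℝ) * (a * n) ^ (i - n) * a * h1

/-- Taking absolute values in the recursion and replacing the birth rates by 1 gives the recursive
inequality satisfied by the majorant. -/
theorem abs_scaledCoeff_le {α : ℝ} (hα : α ≠ 0) (i k : ℕ) :
    |scaledCoeff α k i| ≤ coeffBound (α ^ 2) i k := by
  have ha : 0 ≤ α ^ 2 := sq_nonneg α
  induction i generalizing k with
  | zero =>
    cases k with
    | zero => simp [scaledCoeff, coeffBound, taylorCoeff]
    | succ k => simp [scaledCoeff, coeffBound, taylorCoeff]
  | succ i ih =>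
    rw [scaledCoeff_succ hα]
    cases k with
    | zero =>
      refine le_trans ?_ (coeffBound_zero_succ ha i)
      simp only [forwardOp]
      refine (abs_add_le _ _).trans ?_
      rw [abs_neg, abs_mul, abs_of_nonneg ha]
      gcongr
      · exact ih 0
      · exact ih 1
    | succ k =>
      refine le_trans ?_ (coeffBound_succ_succ ha i k)
      simp only [forwardOp]
      refine (abs_add_le _ _).trans ?_
      refine add_le_add ((abs_sub _ _).trans (add_le_add ?_ ?_)) ?_
      · rw [abs_mul, abs_of_nonneg (by positivity)]
        have h1 : 1 / ((k : ℝ) + 1) ≤ 1 := by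
          rw [div_le_one (by positivity)]
          linarith [k.cast_nonneg (α := ℝ)]
        calc 1 / ((k : ℝ) + 1) * |scaledCoeff α k i| ≤ 1 * |scaledCoeff α k i| := by gcongr
          _ ≤ _ := by rw [one_mul]; exact ih k
      · rw [abs_mul, abs_of_nonneg (by positivity)]
        have h1 : 1 / ((k : ℝ) + 2) ≤ 1 := by
          rw [div_le_one (by positivity)]
          linarith [k.cast_nonneg (α := ℝ)]
        gcongr
        exact ih (k + 1)
      · rw [abs_mul, abs_of_nonneg (by positivity)]
        gcongr
        exact ih (k + 2)

/-- The value at `z = 1` of the polynomial `∑_n C(i,n) (a n)^{i-n} (1 + z)^n`. -/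
noncomputable def totalBound (a : ℝ) (i : ℕ) : ℝ :=
  ∑ n ∈ Finset.range (i + 1), (i.choose n : ℝ) * (a * n) ^ (i - n) * 2 ^ n

theorem sum_coeffBound (a : ℝ) (i : ℕ) :
    ∑ k ∈ Finset.range (i + 1), coeffBound a i k = totalBound a i := by
  simp only [coeffBound, totalBound]
  rw [Finset.sum_comm]
  refine Finset.sum_congr rfl fun n hn => ?_
  rw [← Finset.mul_sum]
  congr 1
  have h1 : ∑ k ∈ Finset.range (i + 1), n.choose k = 2 ^ n := by
    rw [← Nat.sum_range_choose]
    have hsub : Finset.range (n + 1) ⊆ Finset.range (i + 1) :=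
      Finset.range_subset_range.2 (Finset.mem_range.1 hn)
    refine (Finset.sum_subset hsub fun k _ hk => ?_).symm
    rw [Finset.mem_range, not_lt] at hk
    exact Nat.choose_eq_zero_of_lt hk
  exact_mod_cast h1

theorem sum_abs_scaledCoeff_le {α : ℝ} (hα : α ≠ 0) (i : ℕ) :
    ∑ k ∈ Finset.range (i + 1), |scaledCoeff α k i| ≤ totalBound (α ^ 2) i := by
  rw [← sum_coeffBound]
  exact Finset.sum_le_sum fun k _ => abs_scaledCoeff_le hα i k

theorem abs_scaledCoeff_le_totalBound {α : ℝ} (hα : α ≠ 0) (k i : ℕ) :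
    |scaledCoeff α k i| ≤ totalBound (α ^ 2) i := by
  refine le_trans ?_ (sum_abs_scaledCoeff_le hα i)
  rcases le_or_gt k i with h | h
  · exact Finset.single_le_sum (f := fun k => |scaledCoeff α k i|) (fun _ _ => abs_nonneg _)
      (Finset.mem_range.2 (Nat.lt_succ_of_le h))
  · rw [scaledCoeff_eq_zero α h, abs_zero]
    exact Finset.sum_nonneg fun _ _ => abs_nonneg _

/-- With i = n + m the sum becomes the double series of (2r)^n/n! · (anr)^m/m!. Summing over m gives
e^{anr}, then summing over n gives exp(2r e^{ar}). -/
theorem summable_totalBound {a : ℝ} (ha : 0 ≤ a) {r : ℝ} (hr : 0 ≤ r) :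
    Summable fun i : ℕ => r ^ i / (Nat.factorial i : ℝ) * totalBound a i := by
  have hF : Summable fun x : ℕ × ℕ => (2 * r) ^ x.1 / (Nat.factorial x.1 : ℝ)
      * ((a * x.1 * r) ^ x.2 / (Nat.factorial x.2 : ℝ)) := by
    rw [summable_prod_of_nonneg fun x => by positivity]
    constructor
    · intro n
      exact (Real.summable_pow_div_factorial (a * n * r)).mul_left
        ((2 * r) ^ n / (Nat.factorial n : ℝ))
    · have h1 : ∀ n : ℕ, ∑' m : ℕ, (2 * r) ^ n / (Nat.factorial n : ℝ)
          * ((a * n * r) ^ m / (Nat.factorial m : ℝ))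
          = (2 * r * Real.exp (a * r)) ^ n / (Nat.factorial n : ℝ) := by
        intro n
        have h2 : ∑' m : ℕ, (a * n * r) ^ m / (Nat.factorial m : ℝ) = Real.exp (a * n * r) := by
          rw [Real.exp_eq_exp_ℝ]
          exact (NormedSpace.expSeries_div_hasSum_exp (a * n * r)).tsum_eq
        rw [tsum_mul_left, h2, mul_pow _ (Real.exp _), ← Real.exp_nat_mul]
        ring_nf
      simp only [h1]
      exact Real.summable_pow_div_factorial _
  have h2 := (Finset.HasAntidiagonal.sigmaAntidiagonalEquivProd.summable_iff.2 hF).sigma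
  refine h2.congr fun i => ?_
  rw [tsum_fintype, totalBound, Finset.mul_sum, Finset.univ_eq_attach]
  simp only [Function.comp_apply, Finset.HasAntidiagonal.sigmaAntidiagonalEquivProd_apply]
  rw [Finset.sum_attach (Finset.HasAntidiagonal.antidiagonal i) fun x : ℕ × ℕ =>
    (2 * r) ^ x.1 / (Nat.factorial x.1 : ℝ) * ((a * x.1 * r) ^ x.2 / (Nat.factorial x.2 : ℝ)),
    Finset.Nat.sum_antidiagonal_eq_sum_range_succ fun n m : ℕ =>
    (2 * r) ^ n / (Nat.factorial n : ℝ) * ((a * n * r) ^ m / (Nat.factorial m : ℝ))]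
  refine Finset.sum_congr rfl fun n hn => ?_
  have hni : n ≤ i := Nat.lt_succ_iff.1 (Finset.mem_range.1 hn)
  have h3 : r ^ i = r ^ n * r ^ (i - n) := by rw [← pow_add, Nat.add_sub_cancel' hni]
  rw [Nat.cast_choose ℝ hni, h3, mul_pow, mul_pow (a * n)]
  field_simp

theorem summable_scaledCoeff {α : ℝ} (hα : α ≠ 0) (k : ℕ) (r : ℝ) :
    Summable fun i : ℕ => |r| ^ i / (Nat.factorial i : ℝ) * |scaledCoeff α k i| := by
  refine Summable.of_nonneg_of_le (fun i => by positivity) (fun i => ?_)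
    (summable_totalBound (sq_nonneg α) (abs_nonneg r))
  gcongr
  exact abs_scaledCoeff_le_totalBound hα k i

/-! ### Convergence of the series and the differential equations -/

theorem radius_taylorCoeff_eq_top {α : ℝ} (hα : α ≠ 0) (k : ℕ) :
    (FormalMultilinearSeries.ofScalars ℝ
      (fun i : ℕ => taylorCoeff α k i / (Nat.factorial i : ℝ))).radius = ⊤ := by
  refine FormalMultilinearSeries.radius_eq_top_of_summable_norm _ fun r => ?_
  refine ((summable_scaledCoeff hα k r).mul_left
    |α ^ (2 * k) * (Nat.factorial k : ℝ)|).congr fun i => ?_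
  rw [FormalMultilinearSeries.ofScalars_norm, scaledCoeff, Real.norm_eq_abs, abs_div, abs_div,
    Nat.abs_cast, abs_of_nonneg r.coe_nonneg]
  have h1 : |α ^ (2 * k) * (Nat.factorial k : ℝ)| ≠ 0 := by
    rw [abs_ne_zero]
    positivity
  field_simp

theorem analyticOnNhd_seriesSolution {α : ℝ} (hα : α ≠ 0) (k : ℕ) :
    AnalyticOnNhd ℝ (seriesSolution α k) univ := by
  set c : ℕ → ℝ := fun i => taylorCoeff α k i / (Nat.factorial i : ℝ) with hc
  have hr : (FormalMultilinearSeries.ofScalars ℝ c).radius = ⊤ := radius_taylorCoeff_eq_top hα k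
  have hb := (FormalMultilinearSeries.ofScalars ℝ c).hasFPowerSeriesOnBall (by rw [hr]; simp)
  rw [hr] at hb
  have h1 : AnalyticOnNhd ℝ (FormalMultilinearSeries.ofScalars ℝ c).sum univ := by
    have := hb.analyticOnNhd
    simpa using this
  have h2 : seriesSolution α k = fun τ => 1 / (α ^ (2 * k) * (Nat.factorial k : ℝ)) *
      (FormalMultilinearSeries.ofScalars ℝ c).sum τ := by
    funext τ
    have h3 := FormalMultilinearSeries.ofScalars_sum_eq c τ
    rw [FormalMultilinearSeries.ofScalarsSum] at h3
    rw [seriesSolution, h3]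
    congr 1
    refine tsum_congr fun i => ?_
    simp only [hc, smul_eq_mul]
    ring
  rw [h2]
  exact analyticOnNhd_const.mul h1

theorem hasDerivAt_exponentialSeries {c : ℕ → ℝ}
    (hc : ∀ r : ℝ, Summable fun i : ℕ => |r| ^ i / (Nat.factorial i : ℝ) * |c i|)
    (hc' : ∀ r : ℝ, Summable fun i : ℕ => |r| ^ i / (Nat.factorial i : ℝ) * |c (i + 1)|) (t : ℝ) :
    HasDerivAt (fun t => ∑' i : ℕ, t ^ i / (Nat.factorial i : ℝ) * c i)
      (∑' i : ℕ, t ^ i / (Nat.factorial i : ℝ) * c (i + 1)) t := by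
  have hs : ∀ t, Summable fun i : ℕ => t ^ i / (Nat.factorial i : ℝ) * c i := fun t =>
    Summable.of_norm ((hc t).congr fun i => by simp)
  have hfun : (fun t => ∑' i : ℕ, t ^ i / (Nat.factorial i : ℝ) * c i)
      = fun t => c 0 + ∑' i : ℕ, t ^ (i + 1) / (Nat.factorial (i + 1) : ℝ) * c (i + 1) := by
    funext t
    rw [(hs t).tsum_eq_zero_add]
    simp
  rw [hfun]
  refine HasDerivAt.const_add _ ?_
  set R := |t| + 1
  refine hasDerivAt_tsum_of_isPreconnected
    (g := fun (i : ℕ) (t : ℝ) => t ^ (i + 1) / (Nat.factorial (i + 1) : ℝ) * c (i + 1))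
    (g' := fun (i : ℕ) (t : ℝ) => t ^ i / (Nat.factorial i : ℝ) * c (i + 1))
    -- With the constant term split off, every summand vanishes at 0, so convergence at the base
    -- point is trivial.
    (t := Ioo (-R) R) (y₀ := 0) (hc' R) isOpen_Ioo isPreconnected_Ioo
    (fun i y _ => ?_) (fun i y hy => ?_) ?_ ?_ ?_
  · have h1 := ((hasDerivAt_pow (i + 1) y).div_const (Nat.factorial (i + 1) : ℝ)).mul_const
      (c (i + 1))
    have h2 : ((i + 1 : ℕ) : ℝ) * y ^ (i + 1 - 1) / (Nat.factorial (i + 1) : ℝ)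
        = y ^ i / (Nat.factorial i : ℝ) := by
      rw [Nat.factorial_succ, Nat.cast_mul, Nat.add_sub_cancel,
        mul_div_mul_left _ _ (Nat.cast_ne_zero.2 i.succ_ne_zero)]
    exact h2 ▸ h1
  · rw [Real.norm_eq_abs, abs_mul, abs_div, abs_pow, Nat.abs_cast]
    gcongr ?_ ^ _ / _ * _
    exact (abs_lt.2 hy).le.trans (le_abs_self R)
  · constructor <;> simp only [R] <;> linarith [abs_nonneg t]
  · simp
  · exact abs_lt.1 (by simp only [R]; linarith)

theorem forwardOp_tsum (a : ℝ) {x : ℕ → ℕ → ℝ} (hx : ∀ k, Summable (x k)) (k : ℕ) :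
    ∑' i, forwardOp a (fun j => x j i) k = forwardOp a (fun j => ∑' i, x j i) k := by
  cases k with
  | zero =>
    simp only [forwardOp]
    rw [(hx 0).neg.tsum_add ((hx 1).mul_left a), tsum_neg, tsum_mul_left]
  | succ k =>
    simp only [forwardOp]
    rw [(((hx k).mul_left _).sub ((hx (k + 1)).mul_left _)).tsum_add ((hx (k + 2)).mul_left _),
      ((hx k).mul_left _).tsum_sub ((hx (k + 1)).mul_left _), tsum_mul_left, tsum_mul_left,
      tsum_mul_left]

theorem forwardOp_mul_left (a b : ℝ) (x : ℕ → ℝ) (k : ℕ) :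
    forwardOp a (fun j => b * x j) k = b * forwardOp a x k := by
  cases k <;> simp only [forwardOp] <;> ring

theorem summable_seriesSolution {α : ℝ} (hα : α ≠ 0) (k : ℕ) (t : ℝ) :
    Summable fun i : ℕ => t ^ i / (Nat.factorial i : ℝ) * scaledCoeff α k i :=
  Summable.of_norm ((summable_scaledCoeff hα k t).congr fun i => by simp)

theorem summable_scaledCoeff_succ {α : ℝ} (hα : α ≠ 0) (k : ℕ) (r : ℝ) :
    Summable fun i : ℕ => |r| ^ i / (Nat.factorial i : ℝ) * |scaledCoeff α k (i + 1)| := by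
  have h : Summable fun i : ℕ =>
      r ^ i / (Nat.factorial i : ℝ) * scaledCoeff α k (i + 1) := by
    -- The shifted coefficients are finite combinations of unshifted ones, so no new estimate is
    -- needed.
    simp only [scaledCoeff_succ hα, ← forwardOp_mul_left]
    have hs := fun j => summable_seriesSolution hα j r
    cases k with
    | zero => exact (hs 0).neg.add ((hs 1).mul_left _)
    | succ k =>
      exact (((hs k).mul_left _).sub ((hs (k + 1)).mul_left _)).add ((hs (k + 2)).mul_left _)
  exact h.norm.congr fun i => by simp

theorem solvesForward_seriesSolution {α : ℝ} (hα : α ≠ 0) :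
    SolvesForward (α ^ 2) (seriesSolution α) := by
  intro k t _
  have h1 := hasDerivAt_exponentialSeries (summable_scaledCoeff hα k)
    (summable_scaledCoeff_succ hα k) t
  simp only [scaledCoeff_succ hα, ← forwardOp_mul_left] at h1
  rw [forwardOp_tsum _ fun k => summable_seriesSolution hα k t] at h1
  simp only [← seriesSolution_eq_tsum] at h1
  exact h1.hasDerivWithinAt

theorem seriesSolution_at_zero (α : ℝ) (k : ℕ) : seriesSolution α k 0 = scaledCoeff α k 0 := by
  rw [seriesSolution_eq_tsum, tsum_eq_single 0 fun i hi => by simp [hi]]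
  simp

theorem isRescaledSolution_seriesSolution {α : ℝ} (hα : α ≠ 0) :
    IsRescaledSolution α (seriesSolution α) := by
  refine (isRescaledSolution_iff α _).2 ⟨⟨?_, fun k hk => ?_⟩, solvesForward_seriesSolution hα⟩
  · rw [seriesSolution_at_zero, scaledCoeff_zero_zero]
  · rw [seriesSolution_at_zero, scaledCoeff_eq_zero α hk]

/-- The majorant does not depend on k; this uniformity is what the minimum principle requires. -/
theorem exists_abs_seriesSolution_le {α : ℝ} (hα : α ≠ 0) (T : ℝ) :
    ∃ C, ∀ k, ∀ t ∈ Icc 0 T, |seriesSolution α k t| ≤ C := by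
  refine ⟨∑' i : ℕ, |T| ^ i / (Nat.factorial i : ℝ) * totalBound (α ^ 2) i, fun k t ht => ?_⟩
  rw [seriesSolution_eq_tsum, ← Real.norm_eq_abs]
  refine tsum_of_norm_bounded
    (summable_totalBound (sq_nonneg α) (abs_nonneg T)).hasSum fun i => ?_
  rw [Real.norm_eq_abs, abs_mul, abs_div, abs_pow, Nat.abs_cast]
  gcongr ?_ ^ _ / _ * ?_
  · exact abs_le_abs_of_nonneg ht.1 ht.2
  · exact abs_scaledCoeff_le_totalBound hα k i

/-! ### The series solution is a probability distribution -/

theorem seriesSolution_nonneg {α : ℝ} (hα : α ≠ 0) (k : ℕ) {t : ℝ} (ht : 0 ≤ t) :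
    0 ≤ seriesSolution α k t := by
  obtain ⟨C, hC⟩ := exists_abs_seriesSolution_le hα t
  refine (solvesForward_seriesSolution hα).nonneg (sq_nonneg α) (fun k => ?_)
    (fun k s hs => (abs_le.1 (hC k s hs)).1) k t ⟨ht, le_rfl⟩
  rw [seriesSolution_at_zero]
  cases k with
  | zero => rw [scaledCoeff_zero_zero]; exact zero_le_one
  | succ k => rw [scaledCoeff_eq_zero α k.succ_pos]

/-- Conservation of mass: only the net flux between states K and K + 1 survives. -/
theorem sum_forwardOp (a : ℝ) (x : ℕ → ℝ) (K : ℕ) :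
    ∑ k ∈ Finset.range (K + 1), forwardOp a x k
      = a * ((K : ℝ) + 1) * x (K + 1) - 1 / ((K : ℝ) + 1) * x K := by
  induction K with
  | zero =>
    simp [forwardOp]
    ring
  | succ K ih =>
    rw [Finset.sum_range_succ, ih]
    simp only [forwardOp]
    push_cast
    ring

theorem sum_scaledCoeff_succ {α : ℝ} (hα : α ≠ 0) (i : ℕ) :
    ∑ k ∈ Finset.range (i + 2), scaledCoeff α k (i + 1) = 0 := by
  simp only [scaledCoeff_succ hα]
  rw [sum_forwardOp, scaledCoeff_eq_zero α (by omega), scaledCoeff_eq_zero α (by omega)]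
  simp

theorem hasSum_seriesSolution {α : ℝ} (hα : α ≠ 0) (t : ℝ) :
    HasSum (fun k => seriesSolution α k t) 1 := by
  set f : ℕ × ℕ → ℝ := fun x => t ^ x.1 / (Nat.factorial x.1 : ℝ) * scaledCoeff α x.2 x.1 with hf
  have hfin : ∀ i, HasSum (fun k => f (i, k)) (∑ k ∈ Finset.range (i + 1), f (i, k)) := fun i =>
    hasSum_sum_of_ne_finset_zero fun k hk => by
      rw [Finset.mem_range, not_lt] at hk
      simp [hf, scaledCoeff_eq_zero α hk]
  have hfin' : ∀ i, HasSum (fun k => |f (i, k)|) (∑ k ∈ Finset.range (i + 1), |f (i, k)|) :=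
    fun i => hasSum_sum_of_ne_finset_zero fun k hk => by
      rw [Finset.mem_range, not_lt] at hk
      simp [hf, scaledCoeff_eq_zero α hk]
  -- The ℓ¹ bound on each A^i e_0 gives absolute summability over (i, k), which permits exchanging
  -- the two sums.
  have hsum : Summable f := by
    refine Summable.of_norm ((summable_prod_of_nonneg fun x => norm_nonneg _).2
      ⟨fun i => (hfin' i).summable, ?_⟩)
    refine Summable.of_nonneg_of_le (fun i => tsum_nonneg fun k => norm_nonneg _) (fun i => ?_)
      (summable_totalBound (sq_nonneg α) (abs_nonneg t))
    refine ((hfin' i).tsum_eq).trans_le ?_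
    simp only [hf, abs_mul, abs_div, abs_pow, Nat.abs_cast, ← Finset.mul_sum]
    gcongr
    exact sum_abs_scaledCoeff_le hα i
  have hrow : ∀ i, ∑' k, f (i, k) = if i = 0 then 1 else 0 := by
    intro i
    rw [(hfin i).tsum_eq]
    simp only [hf, ← Finset.mul_sum]
    cases i with
    | zero => simp [scaledCoeff_zero_zero]
    | succ i => simp [sum_scaledCoeff_succ hα i]
  have htot : HasSum f 1 := by
    have h1 := hsum.tsum_prod
    simp only [hrow, tsum_ite_eq] at h1
    exact h1 ▸ hsum.hasSum
  have hswap : HasSum (fun x : ℕ × ℕ => f x.swap) 1 :=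
    (Equiv.prodComm ℕ ℕ).hasSum_iff.2 htot
  refine hswap.prod_fiberwise fun k => ?_
  rw [seriesSolution_eq_tsum]
  exact (summable_seriesSolution hα k t).hasSum

theorem isDistributionValued_seriesSolution {α : ℝ} (hα : α ≠ 0) :
    IsDistributionValued (seriesSolution α) := fun t ht =>
  ⟨fun k => seriesSolution_nonneg hα k ht, hasSum_seriesSolution hα t⟩

/-! ### Uniqueness in the two classes -/

theorem IsRescaledSolution.sub_initial {α : ℝ} {p q : ℕ → ℝ → ℝ} (hp : IsRescaledSolution α p)
    (hq : IsRescaledSolution α q) (k : ℕ) : p k 0 - q k 0 = 0 := by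
  cases k with
  | zero => rw [hp.init_zero, hq.init_zero, sub_self]
  | succ k => rw [hp.init_pos _ k.succ_pos, hq.init_pos _ k.succ_pos, sub_self]

theorem IsDistributionValued.mem_Icc {p : ℕ → ℝ → ℝ} (hp : IsDistributionValued p) (k : ℕ) {t : ℝ}
    (ht : 0 ≤ t) : p k t ∈ Icc (0 : ℝ) 1 :=
  ⟨(hp t ht).1 k, le_hasSum (hp t ht).2 k fun j _ => (hp t ht).1 j⟩

theorem IsRescaledSolution.eq_of_isDistributionValued {α : ℝ} {p q : ℕ → ℝ → ℝ}
    (hp : IsRescaledSolution α p) (hq : IsRescaledSolution α q) (hp' : IsDistributionValued p)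
    (hq' : IsDistributionValued q) (k : ℕ) {t : ℝ} (ht : 0 ≤ t) : p k t = q k t := by
  have hd := ((isRescaledSolution_iff α p).1 hp).2.sub ((isRescaledSolution_iff α q).1 hq).2
  refine sub_eq_zero.1 (hd.eq_zero_of_bounded (sq_nonneg α) (hp.sub_initial hq) (T := t) (C := 1)
    (fun k s hs => ?_) k t ⟨ht, le_rfl⟩)
  have h1 := hp'.mem_Icc k hs.1
  have h2 := hq'.mem_Icc k hs.1
  exact abs_le.2 ⟨by linarith [h1.1, h2.2], by linarith [h1.2, h2.1]⟩

/-- The family of time derivatives of a solution is again a solution. -/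
theorem SolvesForward.forwardOp {a : ℝ} {d : ℕ → ℝ → ℝ} (hd : SolvesForward a d) :
    SolvesForward a (fun k t => forwardOp a (fun j => d j t) k) := by
  intro k t ht
  cases k with
  | zero => exact (hd 0 t ht).neg.add ((hd 1 t ht).const_mul a)
  | succ k =>
    exact (((hd k t ht).const_mul _).sub ((hd (k + 1) t ht).const_mul _)).add
      ((hd (k + 2) t ht).const_mul _)

/-- A commutes with d/dt on solutions, so induction on i replaces d by Ad, again a solution with
zero initial data. -/
theorem SolvesForward.iteratedDerivWithin_zero {a : ℝ} {d : ℕ → ℝ → ℝ} (hd : SolvesForward a d)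
    (h0 : ∀ k, d k 0 = 0) (i k : ℕ) : iteratedDerivWithin i (d k) (Ici 0) 0 = 0 := by
  induction i generalizing d with
  | zero => simp [h0]
  | succ i ih =>
    rw [iteratedDerivWithin_succ']
    have h1 : EqOn (derivWithin (d k) (Ici 0)) (fun t => _root_.forwardOp a (fun j => d j t) k)
        (Ici 0) := fun t ht => (hd k t ht).derivWithin (uniqueDiffOn_Ici 0 t ht)
    rw [iteratedDerivWithin_congr h1 self_mem_Ici]
    refine ih hd.forwardOp fun k => ?_
    simp only [h0]
    cases k <;> simp [_root_.forwardOp]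

/-- A function that is analytic on `[0, ∞)` and whose right derivatives at `0` all vanish is zero
on `[0, ∞)`. -/
theorem AnalyticOn.eqOn_zero_of_iteratedDerivWithin {f : ℝ → ℝ} (hf : AnalyticOn ℝ f (Ici 0))
    (h : ∀ i, iteratedDerivWithin i f (Ici 0) 0 = 0) : EqOn f 0 (Ici 0) := by
  have hf0 : f 0 = 0 := by simpa using h 0
  -- Analyticity at the endpoint is one-sided: the extension g has zero Taylor series, so f vanishes
  -- on some (0, ε), and the identity theorem is then applied on the open half-line.
  obtain ⟨g, hfg, hg⟩ := (analyticWithinAt_iff_exists_analyticAt).1 (hf 0 self_mem_Ici)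
  rw [insert_eq_of_mem self_mem_Ici] at hfg
  have hder : ∀ i, iteratedDeriv i g 0 = 0 := by
    intro i
    rw [← iteratedDerivWithin_eq_iteratedDeriv (uniqueDiffOn_Ici 0) hg.contDiffAt self_mem_Ici]
    exact (hfg.iteratedDerivWithin_eq (hfg.self_of_nhdsWithin self_mem_Ici)).symm.trans (h i)
  have hg0 : ∀ᶠ t in nhds 0, g t = 0 := by
    have h1 := hg.hasFPowerSeriesAt
    have h2 : FormalMultilinearSeries.ofScalars ℝ
        (fun n => iteratedDeriv n g 0 / (Nat.factorial n : ℝ)) = 0 := by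
      simp only [hder, zero_div]
      exact FormalMultilinearSeries.ofScalars_series_eq_zero_of_scalar_zero ℝ ℝ
    rw [h2] at h1
    exact h1.eventually_eq_zero
  have hright : ∀ᶠ t in nhdsWithin 0 (Ioi (0 : ℝ)), f t = 0 := by
    filter_upwards [nhdsWithin_mono 0 Ioi_subset_Ici_self hfg, nhdsWithin_le_nhds hg0]
      with t h1 h2
    rw [h1, h2]
  obtain ⟨ε, hε, hzero⟩ := mem_nhdsGT_iff_exists_Ioo_subset.1 hright
  have hε' : (0 : ℝ) < ε := hε
  have hopen : AnalyticOnNhd ℝ f (Ioi 0) :=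
    (isOpen_Ioi.analyticOn_iff_analyticOnNhd).1 (hf.mono Ioi_subset_Ici_self)
  have hmid : f =ᶠ[nhds (ε / 2)] 0 := by
    filter_upwards [Ioo_mem_nhds (half_pos hε') (half_lt_self hε')] with t ht
    exact hzero ht
  have hioi := hopen.eqOn_zero_of_preconnected_of_eventuallyEq_zero isPreconnected_Ioi
    (half_pos hε') hmid
  intro t ht
  rcases (mem_Ici.1 ht).eq_or_lt with h1 | h1
  · rw [← h1, hf0, Pi.zero_apply]
  · exact hioi h1

/-- The component with index `0` determines a solution of the forward equations. -/
theorem SolvesForward.eq_zero_of_component_zero {a : ℝ} (ha : a ≠ 0) {d : ℕ → ℝ → ℝ}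
    (hd : SolvesForward a d) (h0 : EqOn (d 0) 0 (Ici 0)) (k : ℕ) : EqOn (d k) 0 (Ici 0) := by
  have hop : ∀ k, EqOn (d k) 0 (Ici 0) → ∀ t ∈ Ici (0 : ℝ),
      _root_.forwardOp a (fun j => d j t) k = 0 := by
    intro k hk t ht
    refine (uniqueDiffOn_Ici (0 : ℝ) t ht).eq_deriv _ (hd k t ht) ?_
    exact (hasDerivWithinAt_const t (Ici 0) (0 : ℝ)).congr hk (hk ht)
  induction k using Nat.strong_induction_on with
  | _ k ih =>
    match k, ih with
    | 0, _ => exact h0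
    | 1, ih =>
      intro t ht
      have h1 := hop 0 h0 t ht
      have h2 : d 0 t = 0 := h0 ht
      simpa [_root_.forwardOp, h2, ha] using h1
    | k + 2, ih =>
      intro t ht
      have h1 := hop (k + 1) (ih (k + 1) (by omega)) t ht
      have h2 : d k t = 0 := ih k (by omega) ht
      have h3 : d (k + 1) t = 0 := ih (k + 1) (by omega) ht
      have h4 : (k : ℝ) + 2 ≠ 0 := by positivity
      simpa [_root_.forwardOp, h2, h3, ha, h4] using h1

theorem IsRescaledSolution.eq_of_analyticOn {α : ℝ} (hα : α ≠ 0) {p q : ℕ → ℝ → ℝ}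
    (hp : IsRescaledSolution α p) (hq : IsRescaledSolution α q) (hp' : AnalyticOn ℝ (p 0) (Ici 0))
    (hq' : AnalyticOn ℝ (q 0) (Ici 0)) (k : ℕ) {t : ℝ} (ht : 0 ≤ t) : p k t = q k t := by
  have hd := ((isRescaledSolution_iff α p).1 hp).2.sub ((isRescaledSolution_iff α q).1 hq).2
  refine sub_eq_zero.1 (hd.eq_zero_of_component_zero (pow_ne_zero 2 hα) ?_ k ht)
  exact (hp'.sub hq').eqOn_zero_of_iteratedDerivWithin
    fun i => hd.iteratedDerivWithin_zero (hp.sub_initial hq) i 0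

/-! ### Change of time scale and conclusion -/

theorem hasDerivWithinAt_comp_div_iff {c : ℝ} (hc : 0 < c) (f : ℝ → ℝ) (f' : ℝ) {t : ℝ}
    (ht : 0 ≤ t) :
    HasDerivWithinAt (fun s => f (s / c)) (f' / c) (Ici 0) (c * t) ↔
      HasDerivWithinAt f f' (Ici 0) t := by
  constructor
  · intro h
    have h1 : HasDerivWithinAt (fun s => c * s) c (Ici 0) t := by
      simpa using (hasDerivWithinAt_id t (Ici 0)).const_mul c
    have h2 := h.scomp t h1 fun s hs => mul_nonneg hc.le hs
    rw [smul_eq_mul, mul_div_cancel₀ _ hc.ne'] at h2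
    exact h2.congr_of_mem (fun s _ => by simp [mul_div_cancel_left₀ _ hc.ne']) ht
  · intro h
    have h1 : HasDerivWithinAt (fun s => s / c) (1 / c) (Ici 0) (c * t) :=
      (hasDerivWithinAt_id _ _).div_const c
    rw [← mul_div_cancel_left₀ t hc.ne'] at h
    have h2 := h.scomp (c * t) h1 fun s hs => div_nonneg hs hc.le
    rwa [smul_eq_mul, one_div, ← div_eq_inv_mul] at h2

theorem isForwardSolution_iff_rescaled {lam mu α : ℝ} (hlam : 0 < lam) (hα : α ^ 2 = mu / lam)
    (q : ℕ → ℝ → ℝ) :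
    IsForwardSolution lam mu q ↔ IsRescaledSolution α (fun k τ => q k (τ / lam)) := by
  have hmu : mu = lam * α ^ 2 := by rw [hα, mul_div_cancel₀ _ hlam.ne']
  have hall : ∀ P : ℝ → Prop, (∀ t, 0 ≤ t → P (lam * t)) ↔ ∀ τ, 0 ≤ τ → P τ := fun P =>
    ⟨fun h τ hτ => by
      simpa [mul_div_cancel₀ τ hlam.ne'] using h (τ / lam) (div_nonneg hτ hlam.le),
     fun h t ht => h _ (mul_nonneg hlam.le ht)⟩
  have hzero : (∀ t, 0 ≤ t → HasDerivWithinAt (q 0) (-lam * q 0 t + mu * q 1 t) (Ici 0) t) ↔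
      ∀ τ, 0 ≤ τ → HasDerivWithinAt (fun τ => q 0 (τ / lam))
        (-q 0 (τ / lam) + α ^ 2 * q 1 (τ / lam)) (Ici 0) τ := by
    refine Iff.trans (forall₂_congr fun t ht => ?_) (hall _)
    rw [← hasDerivWithinAt_comp_div_iff hlam _ _ ht, mul_div_cancel_left₀ _ hlam.ne', hmu]
    refine iff_of_eq (congrArg (fun y => HasDerivWithinAt _ y _ _) ?_)
    field_simp
  have hpos : ∀ k : ℕ, 1 ≤ k → ((∀ t, 0 ≤ t → HasDerivWithinAt (q k)
      (lam / (k : ℝ) * q (k - 1) t - (lam / (1 + (k : ℝ)) + (k : ℝ) * mu) * q k t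
        + ((k : ℝ) + 1) * mu * q (k + 1) t) (Ici 0) t) ↔
      ∀ τ, 0 ≤ τ → HasDerivWithinAt (fun τ => q k (τ / lam))
        (1 / (k : ℝ) * q (k - 1) (τ / lam)
          - (1 / (1 + (k : ℝ)) + (k : ℝ) * α ^ 2) * q k (τ / lam)
          + ((k : ℝ) + 1) * α ^ 2 * q (k + 1) (τ / lam)) (Ici 0) τ) := by
    intro k hk
    refine Iff.trans (forall₂_congr fun t ht => ?_) (hall _)
    rw [← hasDerivWithinAt_comp_div_iff hlam _ _ ht, mul_div_cancel_left₀ _ hlam.ne', hmu]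
    refine iff_of_eq (congrArg (fun y => HasDerivWithinAt _ y _ _) ?_)
    have : (0 : ℝ) < k := by exact_mod_cast hk
    field_simp
  constructor
  · rintro ⟨h0, h1, h2, h3⟩
    exact ⟨by simpa using h0, fun k hk => by simpa using h1 k hk, hzero.1 h2,
      fun k hk => (hpos k hk).1 (h3 k hk)⟩
  · rintro ⟨h0, h1, h2, h3⟩
    exact ⟨by simpa using h0, fun k hk => by simpa using h1 k hk, hzero.2 h2,
      fun k hk => (hpos k hk).2 (h3 k hk)⟩

theorem mainTheorem1 (lam mu α : ℝ) (hlam : 0 < lam) (hmu : 0 < mu) (hα : α = √(mu / lam)) :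
    (∀ q : ℕ → ℝ → ℝ,
      IsForwardSolution lam mu q ↔ IsRescaledSolution α (fun k τ => q k (τ / lam))) ∧
    (∀ k : ℕ, (FormalMultilinearSeries.ofScalars ℝ
      (fun i : ℕ => taylorCoeff α k i / (Nat.factorial i : ℝ))).radius = ⊤) ∧
    IsRescaledSolution α (seriesSolution α) ∧
    IsDistributionValued (seriesSolution α) ∧
    (∀ k : ℕ, AnalyticOn ℝ (seriesSolution α k) (Ici 0)) ∧
    (∀ p : ℕ → ℝ → ℝ, IsRescaledSolution α p → IsDistributionValued p →
      ∀ k : ℕ, ∀ τ : ℝ, 0 ≤ τ → p k τ = seriesSolution α k τ) ∧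
    (∀ p : ℕ → ℝ → ℝ, IsRescaledSolution α p → AnalyticOn ℝ (p 0) (Ici 0) →
      ∀ k : ℕ, ∀ τ : ℝ, 0 ≤ τ → p k τ = seriesSolution α k τ) := by
  have hratio : 0 < mu / lam := div_pos hmu hlam
  have hα0 : α ≠ 0 := by
    rw [hα]
    exact (Real.sqrt_pos.2 hratio).ne'
  have hα2 : α ^ 2 = mu / lam := by rw [hα, Real.sq_sqrt hratio.le]
  have hsol := isRescaledSolution_seriesSolution hα0
  have hdist := isDistributionValued_seriesSolution hα0
  have han : ∀ k, AnalyticOn ℝ (seriesSolution α k) (Ici 0) := fun k =>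
    ((analyticOnNhd_seriesSolution hα0 k).mono (subset_univ _)).analyticOn
  exact ⟨isForwardSolution_iff_rescaled hlam hα2, radius_taylorCoeff_eq_top hα0, hsol, hdist, han,
    fun p hp hp' k τ hτ => hp.eq_of_isDistributionValued hsol hp' hdist k hτ,
    fun p hp hp' k τ hτ => hp.eq_of_analyticOn hα0 hsol hp' (han 0) k hτ⟩
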